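/- Let $k$ be an algebraically closed field and let $Q$ be a quiver with finitely many vertices, labelled $1,\dots,n$ ($n\ge 1$), such that there are no arrows $i\to j$ whenever $i<j$. Paths are composed from right to left, so in the path algebra $kQ$ the product $pq$ is the path "first $q$, then $p$". Let $I$ be an admissible ideal of $kQ$, that is, a two-sided ideal with $J^m\subseteq I\subseteq J^2$ for some $m\ge 2$, where $J$ is the two-sided ideal generated by the arrows, and let $A=kQ/I$; the images in $A$ of vertices and arrows of $Q$ are denoted and called as in $Q$. Let $R$ be a quiver in $A$, with set of vertices $R_0\subseteq A$ and set of arrows $R_1\subseteq A$, such that * every vertex of $R$ is a sum of distinct vertices of $Q$; * for every arrow $\beta$ of $R$ there are vertices $e,f$ of $Q$ with $\beta=f\beta e$; * every loop of $Q$ is an arrow of $R$. (Only these three properties of the sets $R_0$, $R_1$ are used: it is not required that the vertices of $R$ be orthogonal or sum to $1$, nor that each arrow of $R$ go between two vertices of $R$.) Let $C$ be the unital $k$-subalgebra of $A$ generated by $R_0\cup R_1$, and let $B=zCz^{-1}$ for some unit $z$ of $A$. Then $$\operatorname{gldim}(A,B)\le n-1 .$$ Here a left $A$-module $P$ is called $(A,B)$-projective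 if every surjective $A$-module homomorphism onto $P$ that splits as a $B$-module homomorphism splits as an $A$-module homomorphism. The relative projective dimension of a left $A$-module $M$ is the least $d\ge 0$ for which there is an exact sequence of $A$-modules $0\to P_d\to\cdots\to P_0\to M\to 0$ with all $P_i$ $(A,B)$-projective in which the kernel of every map is a direct summand as a $B$-module (and $\infty$ if there is none), and $\operatorname{gldim}(A,B)$ is the supremum of the relative projective dimensions of all left $A$-modules. -/

import Mathlib

/-- The paths of a quiver `V` (with arbitrary start and end point, stationary paths included). -/
abbrev TotalPath (V : Type*) [Quiver V] := Σ a b : V, Quiver.Path a b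

/-- The path algebra `kV` of a quiver `V`: the vector space with basis the paths of `V`. -/
def PathAlgebra (k : Type*) [Field k] (V : Type*) [Quiver V] := TotalPath V →₀ k

namespace PathAlgebra

section

variable (k : Type*) [Field k] {V : Type*} [Quiver V]

noncomputable instance : AddCommGroup (PathAlgebra k V) :=
  inferInstanceAs (AddCommGroup (TotalPath V →₀ k))

noncomputable instance : Module k (PathAlgebra k V) :=
  inferInstanceAs (Module k (TotalPath V →₀ k))

/-- The basis of the path algebra given by the paths. -/
noncomputable def basis : Module.Basis (TotalPath V) k (PathAlgebra k V) :=
  Module.Basis.ofRepr (LinearEquiv.refl k (TotalPath V →₀ k))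

/-- The basis element of the path algebra given by a path. -/
noncomputable def ofPath {a b : V} (p : Quiver.Path a b) : PathAlgebra k V :=
  basis k ⟨a, b, p⟩

/-- The vertex `a`, as the stationary path at `a`. -/
noncomputable def vertex (a : V) : PathAlgebra k V := ofPath k (Quiver.Path.nil : Quiver.Path a a)

/-- An arrow, as a path of length one. -/
noncomputable def arrow {a b : V} (α : a ⟶ b) : PathAlgebra k V := ofPath k α.toPath

noncomputable instance [Fintype V] : One (PathAlgebra k V) := ⟨∑ a : V, vertex k a⟩

variable {k}

theorem one_def [Fintype V] : (1 : PathAlgebra k V) = ∑ a : V, vertex k a := rfl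

theorem hom_ext {M : Type*} [AddCommMonoid M] [Module k M] {f g : PathAlgebra k V →ₗ[k] M}
    (h : ∀ (a b : V) (p : Quiver.Path a b), f (ofPath k p) = g (ofPath k p)) : f = g :=
  (basis k).ext fun p => h p.1 p.2.1 p.2.2

variable (k) [DecidableEq V]

/-- The product `p q` of two paths: first `q`, then `p`, if `q` ends where `p` starts,
and `0` otherwise. -/
noncomputable def mulPath (p q : TotalPath V) : PathAlgebra k V :=
  if h : q.2.1 = p.1 then ofPath k (q.2.2.comp (p.2.2.cast h.symm rfl)) else 0

/-- The multiplication of the path algebra: the bilinear extension of the product of paths. -/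
noncomputable def mulHom : PathAlgebra k V →ₗ[k] PathAlgebra k V →ₗ[k] PathAlgebra k V :=
  (basis k).constr k fun p => (basis k).constr k fun q => mulPath k p q

noncomputable instance : Mul (PathAlgebra k V) := ⟨fun x y => mulHom k x y⟩

variable {k}

theorem mul_def (x y : PathAlgebra k V) : x * y = mulHom k x y := rfl

theorem mulHom_ofPath {a b c d : V} (p : Quiver.Path c d) (q : Quiver.Path a b) :
    mulHom k (ofPath k p) (ofPath k q) = mulPath k ⟨c, d, p⟩ ⟨a, b, q⟩ := by
  simp only [mulHom, ofPath, Module.Basis.constr_basis]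

theorem ofPath_mul_ofPath {a b c : V} (p : Quiver.Path b c) (q : Quiver.Path a b) :
    ofPath k p * ofPath k q = ofPath k (q.comp p) := by
  rw [mul_def, mulHom_ofPath]; simp [mulPath]

theorem ofPath_mul_ofPath_of_ne {a b c d : V} (p : Quiver.Path c d) (q : Quiver.Path a b)
    (h : b ≠ c) : ofPath k p * ofPath k q = 0 := by
  rw [mul_def, mulHom_ofPath]; simp [mulPath, h]

protected theorem zero_mul (x : PathAlgebra k V) : 0 * x = 0 := by simp [mul_def]

protected theorem mul_zero (x : PathAlgebra k V) : x * 0 = 0 := by simp [mul_def]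

theorem mul_assoc_ofPath {a b c d e f : V} (p : Quiver.Path e f) (q : Quiver.Path c d)
    (r : Quiver.Path a b) :
    ofPath k p * ofPath k q * ofPath k r = ofPath k p * (ofPath k q * ofPath k r) := by
  by_cases h : d = e
  · subst h
    by_cases h' : b = c
    · subst h'
      simp only [ofPath_mul_ofPath, Quiver.Path.comp_assoc]
    · rw [ofPath_mul_ofPath, ofPath_mul_ofPath_of_ne _ _ h', ofPath_mul_ofPath_of_ne _ _ h',
        PathAlgebra.mul_zero]
  · rw [ofPath_mul_ofPath_of_ne _ _ h, PathAlgebra.zero_mul]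
    by_cases h' : b = c
    · subst h'
      rw [ofPath_mul_ofPath, ofPath_mul_ofPath_of_ne _ _ h]
    · rw [ofPath_mul_ofPath_of_ne _ _ h', PathAlgebra.mul_zero]

protected theorem mul_assoc (x y z : PathAlgebra k V) : x * y * z = x * (y * z) := by
  have h₁ : ∀ (a b c d : V) (p : Quiver.Path a b) (q : Quiver.Path c d),
      mulHom k (ofPath k p * ofPath k q) = mulHom k (ofPath k p) ∘ₗ mulHom k (ofPath k q) :=
    fun a b c d p q => hom_ext fun e f r => mul_assoc_ofPath p q r
  have h₂ : ∀ (a b : V) (p : Quiver.Path a b), (mulHom k).flip z ∘ₗ mulHom k (ofPath k p) =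
      mulHom k (ofPath k p) ∘ₗ (mulHom k).flip z :=
    fun a b p => hom_ext fun c d q => LinearMap.congr_fun (h₁ a b c d p q) z
  have h₃ : (mulHom k).flip z ∘ₗ (mulHom k).flip y = (mulHom k).flip (y * z) :=
    hom_ext fun a b p => LinearMap.congr_fun (h₂ a b p) y
  exact LinearMap.congr_fun h₃ x

protected theorem one_mul [Fintype V] (x : PathAlgebra k V) : 1 * x = x := by
  suffices h : mulHom k (1 : PathAlgebra k V) = LinearMap.id from LinearMap.congr_fun h x
  refine hom_ext fun a b p => ?_
  rw [one_def, map_sum, LinearMap.sum_apply, Finset.sum_eq_single b]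
  · exact ofPath_mul_ofPath _ _
  · exact fun c _ hc => ofPath_mul_ofPath_of_ne _ _ hc.symm
  · simp

protected theorem mul_one [Fintype V] (x : PathAlgebra k V) : x * 1 = x := by
  suffices h : (mulHom k).flip (1 : PathAlgebra k V) = LinearMap.id from LinearMap.congr_fun h x
  refine hom_ext fun a b p => ?_
  rw [LinearMap.flip_apply, one_def, map_sum, Finset.sum_eq_single a]
  · exact (ofPath_mul_ofPath p Quiver.Path.nil).trans (by simp [Quiver.Path.nil_comp])
  · exact fun c _ hc => ofPath_mul_ofPath_of_ne p Quiver.Path.nil hc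
  · simp

noncomputable instance [Fintype V] : Ring (PathAlgebra k V) :=
  { (inferInstance : AddCommGroup (PathAlgebra k V)) with
    mul := (· * ·)
    one := 1
    mul_assoc := PathAlgebra.mul_assoc
    one_mul := PathAlgebra.one_mul
    mul_one := PathAlgebra.mul_one
    zero_mul := PathAlgebra.zero_mul
    mul_zero := PathAlgebra.mul_zero
    left_distrib := fun x y z => by simp [mul_def]
    right_distrib := fun x y z => by simp [mul_def] }

noncomputable instance [Fintype V] : Algebra k (PathAlgebra k V) :=
  Algebra.ofModule (fun r x y => by simp [mul_def]) (fun r x y => by simp [mul_def])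

variable (k V) in
/-- The arrow ideal: the two-sided ideal generated by the arrows. -/
noncomputable def arrowIdeal [Fintype V] : Ideal (PathAlgebra k V) :=
  (TwoSidedIdeal.span {x | ∃ (a b : V) (α : a ⟶ b), x = arrow k α}).asIdeal

/-- The class of the vertex `a` in `kV / I`. -/
noncomputable def vertexIn [Fintype V] (I : Ideal (PathAlgebra k V)) [I.IsTwoSided] (a : V) :
    PathAlgebra k V ⧸ I :=
  Ideal.Quotient.mk I (vertex k a)

/-- The class of an arrow in `kV / I`. -/
noncomputable def arrowIn [Fintype V] (I : Ideal (PathAlgebra k V)) [I.IsTwoSided] {a b : V}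
    (α : a ⟶ b) : PathAlgebra k V ⧸ I :=
  Ideal.Quotient.mk I (arrow k α)

/-- A (two-sided) ideal `I` is admissible if `J ^ m ⊆ I ⊆ J ^ 2` for some `m ≥ 2`,
where `J` is the arrow ideal. -/
def IsAdmissible [Fintype V] (I : Ideal (PathAlgebra k V)) [I.IsTwoSided] : Prop :=
  I ≤ arrowIdeal k V ^ 2 ∧ ∃ m : ℕ, 2 ≤ m ∧ arrowIdeal k V ^ m ≤ I

end

end PathAlgebra

section

universe u

variable {k : Type*} [CommRing k] {A : Type u} [Ring A] [Algebra k A] (B : Subalgebra k A)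

/-- `M` is relatively `B`-projective (`(A, B)`-projective): every `A`-module homomorphism onto `M`
that splits as a `B`-module homomorphism splits as an `A`-module homomorphism. -/
def IsRelProjective (M : Type u) [AddCommGroup M] [Module A M] : Prop :=
  ∀ (N : ModuleCat.{u} A) (f : N →ₗ[A] M), Function.Surjective f →
    (∃ s : M →ₗ[B] N, ∀ x, f (s x) = x) → ∃ s : M →ₗ[A] N, ∀ x, f (s x) = x

/-- The submodule `K` of the `A`-module `M` is a direct summand of `M` as a `B`-module. -/
def IsDirectSummandOver {M : Type u} [AddCommGroup M] [Module A M] (K : Submodule A M) : Prop :=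
  IsComplemented (K.restrictScalars B)

/-- An `(A, B)`-exact sequence `0 → P n → ⋯ → P 1 → P 0 → M → 0` of `A`-modules
with all `P i` relatively `B`-projective. The sequence is continued by zero modules `P i`, `n < i`. -/
structure RelProjResolution (M : Type u) [AddCommGroup M] [Module A M] (n : ℕ) where
  P : ℕ → ModuleCat.{u} A
  d : ∀ i, P (i + 1) →ₗ[A] P i
  ε : P 0 →ₗ[A] M
  projective : ∀ i, IsRelProjective B (P i)
  eq_zero : ∀ i, n < i → Subsingleton (P i)
  surjective : Function.Surjective ε
  exact_zero : LinearMap.range (d 0) = LinearMap.ker ε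
  exact_succ : ∀ i, LinearMap.range (d (i + 1)) = LinearMap.ker (d i)
  summand_zero : IsDirectSummandOver B (LinearMap.ker ε)
  summand_succ : ∀ i, IsDirectSummandOver B (LinearMap.ker (d i))

/-- The relative projective dimension of the `A`-module `M`: the least `n` such that `M` has a
relative projective resolution of length `n`, and `⊤` if there is none. -/
noncomputable def relProjDim (M : Type u) [AddCommGroup M] [Module A M] : ℕ∞ :=
  sInf {d : ℕ∞ | ∃ n : ℕ, d = n ∧ Nonempty (RelProjResolution B M n)}

/-- The left relative global dimension `gldim(A, B)` of the extension `B ⊆ A`: the supremum of the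
relative projective dimensions of all left `A`-modules. -/
noncomputable def relGldim : ℕ∞ := ⨆ M : ModuleCat.{u} A, relProjDim B M

/-- `B` is conjugate to `C`: `B = z C z⁻¹` for some unit `z` of `A`. -/
def IsConjugateSubalgebra (C : Subalgebra k A) : Prop :=
  ∃ z : Aˣ, (B : Set A) = {x | ∃ c ∈ C, x = z * c * (z⁻¹ : Aˣ)}

end

-- Let `D` be the algebra generated by `R₁` and all vertices `e i` of `Q`. It contains the algebra
-- `C` generated by `R₀ ∪ R₁`. Splittings over `B = z C z⁻¹` and over `D` are interchangeable. If
-- `φ` is `D`-linear, `x ↦ z φ(z⁻¹ x)` is `B`-linear (`isTransfer_conj`); if `φ` is `B`-linear, `x ↦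
-- ∑ e i z⁻¹ φ(z e i x)` is `D`-linear (`isTransfer_adjoin`). Both operations preserve sections and
-- retractions of `A`-linear maps, so a relative resolution over `D` is one over `B`.
--
-- Over `D` the standard resolution is short. Labels weakly decrease along paths, so a closed path
-- is a product of loops and `D` contains every corner `e i A e i`. If `M` lives on labels at most
-- `t`, then above each vertex of label at least `t` the map `A ⊗_D M → M` is injective, so its
-- kernel lives on labels below `t` (`Induced.smul_eq_zero_of_mem_ker_counit`). Starting from `t = n
-- - 1`, the process stops in time.

universe u

/-! ### Transfer of splittings between subalgebras -/

section Transfer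

variable {k : Type*} [CommRing k] {A : Type u} [Ring A] [Algebra k A]

/-- `∑ i, a i ⊗ b i` is mapped to `1` by the multiplication, and averaging a `B`-linear map over it
gives a `C`-linear map. -/
structure IsTransfer (B C : Subalgebra k A) {ι : Type*} [Fintype ι] (a b : ι → A) : Prop where
  sum_mul : ∑ i, a i * b i = 1
  map_smul : ∀ (M N : Type u) [AddCommGroup M] [Module A M] [AddCommGroup N] [Module A N]
    (φ : M →ₗ[B] N) (c : C) (x : M),
    ∑ i, a i • φ (b i • (c : A) • x) = (c : A) • ∑ i, a i • φ (b i • x)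

namespace IsTransfer

variable {B C : Subalgebra k A} {ι : Type*} [Fintype ι] {a b : ι → A}

/-- The average of a `B`-linear map. -/
def average (h : IsTransfer B C a b) {M N : Type u} [AddCommGroup M] [Module A M] [AddCommGroup N]
    [Module A N] (φ : M →ₗ[B] N) : M →ₗ[C] N where
  toFun x := ∑ i, a i • φ (b i • x)
  map_add' x y := by simp [Finset.sum_add_distrib]
  map_smul' c x := h.map_smul M N φ c x

theorem average_apply (h : IsTransfer B C a b) {M N : Type u} [AddCommGroup M] [Module A M]
    [AddCommGroup N] [Module A N] (φ : M →ₗ[B] N) (x : M) :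
    h.average φ x = ∑ i, a i • φ (b i • x) := rfl

theorem sum_smul_smul (h : IsTransfer B C a b) {M : Type u} [AddCommGroup M] [Module A M] (x : M) :
    ∑ i, a i • b i • x = x := by
  simp_rw [← mul_smul, ← Finset.sum_smul, h.sum_mul, one_smul]

/-- As `f` is `A`-linear, it passes through the average of `s`, leaving `∑ a i b i x = x`. -/
theorem exists_section (h : IsTransfer B C a b) {M N : Type u} [AddCommGroup M] [Module A M]
    [AddCommGroup N] [Module A N] {f : N →ₗ[A] M} (hs : ∃ s : M →ₗ[B] N, ∀ x, f (s x) = x) :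
    ∃ s : M →ₗ[C] N, ∀ x, f (s x) = x := by
  obtain ⟨s, hs⟩ := hs
  exact ⟨h.average s, fun x => by simp [average_apply, hs, h.sum_smul_smul]⟩

/-- Projectivity moves against the direction of splittings: a test map split over `B` is also split
over `C`. -/
theorem isRelProjective (h : IsTransfer B C a b) {M : Type u} [AddCommGroup M] [Module A M]
    (hM : IsRelProjective C M) : IsRelProjective B M :=
  fun N f hf hs => hM N f hf (h.exists_section hs)

end IsTransfer

theorem isDirectSummandOver_iff (B : Subalgebra k A) {M : Type u} [AddCommGroup M] [Module A M]
    (K : Submodule A M) :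
    IsDirectSummandOver B K ↔ ∃ p : M →ₗ[B] K, ∀ x : K, p x = x := by
  constructor
  · rintro ⟨q, hq⟩
    exact ⟨Submodule.projectionOnto (K.restrictScalars B) q hq,
      fun x => Submodule.projectionOnto_apply_left hq x⟩
  · rintro ⟨p, hp⟩
    exact ⟨LinearMap.ker p, LinearMap.isCompl_of_proj (p := K.restrictScalars B) hp⟩

theorem isDirectSummandOver_ker (B : Subalgebra k A) {M N : Type u} [AddCommGroup M] [Module A M]
    [AddCommGroup N] [Module A N] (f : N →ₗ[A] M) (s : M →ₗ[B] N) (hs : ∀ x, f (s x) = x) :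
    IsDirectSummandOver B (LinearMap.ker f) := by
  rw [isDirectSummandOver_iff]
  refine ⟨⟨⟨fun x => ⟨x - s (f x), by simp [hs]⟩, fun x y => ?_⟩, fun c x => ?_⟩, fun x => ?_⟩
  · ext
    simp only [map_add, Submodule.coe_add]
    abel
  · ext
    have : f (c • x) = c • f x := f.map_smul (c : A) x
    simp [this, smul_sub]
  · ext
    simp

/-- Averaging a retraction onto `K` works because `K` is an `A`-submodule: each `b i • x` with `x`
in `K` is again fixed by `p`. -/
theorem IsTransfer.isDirectSummandOver {B C : Subalgebra k A} {ι : Type*} [Fintype ι] {a b : ι → A}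
    (h : IsTransfer B C a b) {M : Type u} [AddCommGroup M] [Module A M] {K : Submodule A M}
    (hK : IsDirectSummandOver B K) : IsDirectSummandOver C K := by
  rw [isDirectSummandOver_iff] at hK ⊢
  obtain ⟨p, hp⟩ := hK
  refine ⟨h.average p, fun x => ?_⟩
  have : ∀ i, p (b i • (x : M)) = b i • x := fun i => hp (b i • x)
  simp [average_apply, this, h.sum_smul_smul]

/-- A relative resolution over `C` is one over `B` if splittings can be transferred both ways. -/
def RelProjResolution.transfer {B C : Subalgebra k A} {ι κ : Type*} [Fintype ι] [Fintype κ]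
    {a b : ι → A} {a' b' : κ → A} (h : IsTransfer B C a b) (h' : IsTransfer C B a' b')
    {M : Type u} [AddCommGroup M] [Module A M] {n : ℕ} (r : RelProjResolution C M n) :
    RelProjResolution B M n where
  P := r.P
  d := r.d
  ε := r.ε
  projective i := h.isRelProjective (r.projective i)
  eq_zero := r.eq_zero
  surjective := r.surjective
  exact_zero := r.exact_zero
  exact_succ := r.exact_succ
  summand_zero := h'.isDirectSummandOver r.summand_zero
  summand_succ i := h'.isDirectSummandOver (r.summand_succ i)

end Transfer

/-! ### The induced module `A ⊗_C M` -/

section Induced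

variable {k : Type*} [CommRing k] {A : Type u} [Ring A] [Algebra k A] (C : Subalgebra k A)
  (M : Type u) [AddCommGroup M] [Module A M]

/-- The relations between the symbols `a ⊗ m` in `A ⊗_C M`. -/
noncomputable def inducedRelations : Submodule A (M →₀ A) :=
  Submodule.span A
    ({x | ∃ m m' : M, x = Finsupp.single (m + m') 1 - Finsupp.single m 1 - Finsupp.single m' 1} ∪
      {x | ∃ (c : C) (m : M), x = Finsupp.single (c • m) 1 - Finsupp.single m (c : A)})

/-- The induced module `A ⊗_C M`. -/
abbrev Induced : Type u := (M →₀ A) ⧸ inducedRelations C M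

namespace Induced

variable {M}

/-- The `C`-linear map `m ↦ 1 ⊗ m`. -/
noncomputable def unit : M →ₗ[C] Induced C M where
  toFun m := (inducedRelations C M).mkQ (Finsupp.single m 1)
  map_add' m m' := by
    rw [← map_add, ← sub_eq_zero, ← map_sub, ← LinearMap.mem_ker, Submodule.ker_mkQ, ← sub_sub]
    exact Submodule.subset_span (Or.inl ⟨m, m', rfl⟩)
  map_smul' c m := by
    rw [RingHom.id_apply, Subalgebra.smul_def c ((inducedRelations C M).mkQ _), ← map_smul,
      ← sub_eq_zero, ← map_sub, ← LinearMap.mem_ker, Submodule.ker_mkQ, Finsupp.smul_single,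
      smul_eq_mul, mul_one]
    exact Submodule.subset_span (Or.inr ⟨c, m, rfl⟩)

theorem smul_unit (a : A) (m : M) :
    a • unit C m = (inducedRelations C M).mkQ (Finsupp.single m a) := by
  change a • (inducedRelations C M).mkQ (Finsupp.single m 1) = _
  rw [← map_smul, Finsupp.smul_single, smul_eq_mul, mul_one]

theorem unit_smul {c : A} (hc : c ∈ C) (m : M) : unit C (c • m) = c • unit C m :=
  (unit C).map_smul ⟨c, hc⟩ m

theorem induction_on {p : Induced C M → Prop} (zero : p 0) (add : ∀ x y, p x → p y → p (x + y))
    (smul_unit : ∀ (a : A) (m : M), p (a • unit C m)) (x : Induced C M) : p x := by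
  obtain ⟨x, rfl⟩ := (inducedRelations C M).mkQ_surjective x
  induction x using Finsupp.induction_linear with
  | zero => simpa using zero
  | add x y hx hy => simpa using add _ _ hx hy
  | single m a => simpa [Induced.smul_unit] using smul_unit a m

variable {C} {N : Type u} [AddCommGroup N] [Module A N]

/-- The `A`-linear extension of a `C`-linear map `M → N` to `A ⊗_C M`. -/
noncomputable def lift (g : M →ₗ[C] N) : Induced C M →ₗ[A] N :=
  (inducedRelations C M).liftQ (Finsupp.linearCombination A g) (by
    rw [inducedRelations, Submodule.span_le]
    rintro _ (⟨m, m', rfl⟩ | ⟨c, m, rfl⟩)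
    · simp
    · simp [Subalgebra.smul_def c (g m)])

@[simp]
theorem lift_unit (g : M →ₗ[C] N) (m : M) : lift g (unit C m) = g m := by
  change (inducedRelations C M).liftQ _ _ ((inducedRelations C M).mkQ _) = _
  simp

variable (C M)

/-- A `C`-linear section is needed only on the generators `1 ⊗ m`; restricted to these, it extends
`A`-linearly by the universal property. -/
theorem isRelProjective : IsRelProjective C (Induced C M) := by
  rintro N f - ⟨s, hs⟩
  refine ⟨lift (s ∘ₗ unit C), fun x => ?_⟩
  induction x using induction_on with
  | zero => simp
  | add x y hx hy => simp [hx, hy]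
  | smul_unit a m => simp [hs]

/-- The multiplication map `A ⊗_C M → M`. -/
noncomputable def counit : Induced C M →ₗ[A] M := lift (LinearMap.id : M →ₗ[C] M)

theorem counit_unit (m : M) : counit C M (unit C m) = m := by simp [counit]

end Induced

end Induced

/-! ### Relative resolutions over triangular algebras -/

section Resolution

variable {k : Type*} [CommRing k] {A : Type u} [Ring A] [Algebra k A] {C : Subalgebra k A}

theorem isRelProjective_of_subsingleton (M : Type u) [AddCommGroup M] [Module A M]
    [Subsingleton M] : IsRelProjective C M :=
  fun _ _ _ _ => ⟨0, fun _ => Subsingleton.elim _ _⟩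

theorem isDirectSummandOver_of_subsingleton {M : Type u} [AddCommGroup M] [Module A M]
    [Subsingleton M] (K : Submodule A M) : IsDirectSummandOver C K := by
  rw [isDirectSummandOver_iff]
  exact ⟨0, fun _ => Subsingleton.elim _ _⟩

variable {M : Type u} [AddCommGroup M] [Module A M]

/-- The relative resolution of length `0` given by a bijection onto `M`. -/
noncomputable def RelProjResolution.ofBijective (P : ModuleCat.{u} A) (hP : IsRelProjective C P)
    (f : P →ₗ[A] M) (hf : Function.Surjective f) (hker : LinearMap.ker f = ⊥) :
    RelProjResolution C M 0 where
  P i := match i with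
    | 0 => P
    | _ + 1 => ModuleCat.of A PUnit
  d _ := 0
  ε := f
  projective i := match i with
    | 0 => hP
    | _ + 1 => isRelProjective_of_subsingleton PUnit
  eq_zero i hi := match i with
    | _ + 1 => inferInstanceAs (Subsingleton PUnit)
  surjective := hf
  exact_zero := by rw [hker, LinearMap.range_zero]
  exact_succ i := by
    have : Subsingleton (ModuleCat.of A PUnit.{u + 1}) := inferInstanceAs (Subsingleton PUnit)
    exact Subsingleton.elim (α := Submodule A (ModuleCat.of A PUnit.{u + 1})) _ _
  summand_zero := by
    rw [hker, isDirectSummandOver_iff]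
    exact ⟨0, fun _ => Subsingleton.elim _ _⟩
  summand_succ i := isDirectSummandOver_of_subsingleton (M := PUnit) _

/-- Splicing a relative resolution of a kernel. -/
noncomputable def RelProjResolution.splice (P : ModuleCat.{u} A) (hP : IsRelProjective C P)
    (f : P →ₗ[A] M) (hf : Function.Surjective f) (hker : IsDirectSummandOver C (LinearMap.ker f))
    {n : ℕ} (r : RelProjResolution C (LinearMap.ker f) n) : RelProjResolution C M (n + 1) where
  P i := match i with
    | 0 => P
    | i + 1 => r.P i
  d i := match i with
    | 0 => (LinearMap.ker f).subtype ∘ₗ r.ε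
    | i + 1 => r.d i
  ε := f
  projective i := match i with
    | 0 => hP
    | i + 1 => r.projective i
  eq_zero i hi := match i with
    | i + 1 => r.eq_zero i (by omega)
  surjective := hf
  exact_zero := by
    rw [LinearMap.range_comp, LinearMap.range_eq_top.2 r.surjective, Submodule.map_top,
      Submodule.range_subtype]
  exact_succ i := match i with
    | 0 => by
      rw [LinearMap.ker_comp_of_ker_eq_bot _ (Submodule.ker_subtype _)]
      exact r.exact_zero
    | i + 1 => r.exact_succ i
  summand_zero := hker
  summand_succ i := match i with
    | 0 => by
      rw [LinearMap.ker_comp_of_ker_eq_bot _ (Submodule.ker_subtype _)]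
      exact r.summand_zero
    | i + 1 => r.summand_succ i

variable {V : Type*} [Fintype V] {e : V → A} {label : V → ℕ}

/-- If `A` is triangular with respect to idempotents whose corners lie in `C`, then the kernel of
`A ⊗_C M → M` is supported below the highest vertex of the support of `M`. -/
theorem Induced.smul_eq_zero_of_mem_ker_counit (hsum : ∑ i, e i = 1) (he : ∀ i, e i * e i = e i)
    (heC : ∀ i, e i ∈ C) (hinj : Function.Injective label)
    (htri : ∀ i j a, label i < label j → e j * a * e i = 0)
    (hcorner : ∀ i a, e i * a * e i ∈ C) {t : ℕ}
    (hM : ∀ j, t < label j → ∀ x : M, e j • x = 0) {j : V} (hj : t ≤ label j)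
    {x : Induced C M} (hx : x ∈ LinearMap.ker (Induced.counit C M)) : e j • x = 0 := by
  -- Elements `1 ⊗ m` are determined by their image `m` in `M`, so this makes the multiplication map
  -- injective on the `e j`-component.
  have key : ∀ x : Induced C M, ∃ m : M, e j • x = Induced.unit C m := fun x => by
    induction x using Induced.induction_on with
    | zero => exact ⟨0, by simp⟩
    | add x y hx hy =>
      obtain ⟨m, hm⟩ := hx
      obtain ⟨m', hm'⟩ := hy
      exact ⟨m + m', by rw [smul_add, hm, hm', map_add]⟩
    | smul_unit a m =>
      refine ⟨(e j * a * e j) • m, ?_⟩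
      rw [Induced.unit_smul C (hcorner j a), ← mul_smul]
      conv_lhs => rw [← mul_one (e j * a), ← hsum, Finset.mul_sum, Finset.sum_smul]
      -- In `∑ e j a e i ⊗ m`, lower labels `i` vanish by triangularity and higher ones since `e i`
      -- moves across the tensor and kills `m`. For `i = j` the corner element itself moves across.
      refine Finset.sum_eq_single j (fun i _ hij => ?_) (by simp)
      rcases lt_or_gt_of_ne (hinj.ne hij) with h | h
      · rw [htri i j a h, zero_smul]
      · rw [← he i, ← mul_assoc, mul_smul, ← Induced.unit_smul C (heC i), hM i (hj.trans_lt h),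
          map_zero, smul_zero]
  obtain ⟨m, hm⟩ := key x
  have : m = 0 := by
    rw [← Induced.counit_unit C M m, ← hm, map_smul, LinearMap.mem_ker.1 hx, smul_zero]
  rw [hm, this, map_zero]

/-- The length of a relative resolution over a triangular algebra is bounded by the support. -/
theorem nonempty_relProjResolution_of_triangular (hsum : ∑ i, e i = 1) (he : ∀ i, e i * e i = e i)
    (heC : ∀ i, e i ∈ C) (hinj : Function.Injective label)
    (htri : ∀ i j a, label i < label j → e j * a * e i = 0)
    (hcorner : ∀ i a, e i * a * e i ∈ C) (t : ℕ) (M : Type u) [AddCommGroup M] [Module A M]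
    (hM : ∀ j, t < label j → ∀ x : M, e j • x = 0) : Nonempty (RelProjResolution C M t) := by
  have hsurj : ∀ (M : Type u) [AddCommGroup M] [Module A M],
      Function.Surjective (Induced.counit C M) :=
    fun M _ _ x => ⟨_, Induced.counit_unit C M x⟩
  induction t generalizing M with
  | zero =>
    refine ⟨.ofBijective (ModuleCat.of A (Induced C M)) (Induced.isRelProjective C M)
      (Induced.counit C M) (hsurj M) ((Submodule.eq_bot_iff _).2 fun x hx => ?_)⟩
    -- For `t = 0` every label is at least `t`, so all `e j`, and hence `1`, kill the kernel.
    rw [← one_smul A x, ← hsum, Finset.sum_smul]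
    exact Finset.sum_eq_zero fun j _ => Induced.smul_eq_zero_of_mem_ker_counit hsum he heC hinj
      htri hcorner hM (Nat.zero_le _) hx
  | succ t ih =>
    obtain ⟨r⟩ := ih (LinearMap.ker (Induced.counit C M)) fun j hj x => Subtype.ext
      (Induced.smul_eq_zero_of_mem_ker_counit hsum he heC hinj htri hcorner hM hj x.2)
    exact ⟨.splice (ModuleCat.of A (Induced C M)) (Induced.isRelProjective C M)
      (Induced.counit C M) (hsurj M)
      (isDirectSummandOver_ker C _ (Induced.unit C) (Induced.counit_unit C M)) r⟩

end Resolution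

/-! ### Transfers for a conjugate subalgebra -/

section Conjugation

variable {k : Type*} [CommRing k] {A : Type u} [Ring A] [Algebra k A]

theorem smul_smul_of_coe_eq {B : Subalgebra k A} {M N : Type u} [AddCommGroup M] [Module A M]
    [AddCommGroup N] [Module A N] (φ : M →ₗ[B] N) {b : A} (hb : b ∈ B) (x : M) :
    φ (b • x) = b • φ x :=
  φ.map_smul ⟨b, hb⟩ x

/-- Splittings over `C'` give splittings over every subalgebra `z C z⁻¹` with `C ≤ C'`. -/
theorem isTransfer_conj {B C C' : Subalgebra k A} (z : Aˣ)
    (hB : (B : Set A) = {x | ∃ c ∈ C, x = z * c * (z⁻¹ : Aˣ)}) (hC : C ≤ C') :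
    IsTransfer C' B (fun _ : Unit => (z : A)) (fun _ : Unit => ((z⁻¹ : Aˣ) : A)) where
  sum_mul := by simp
  map_smul M N _ _ _ _ φ c x := by
    obtain ⟨c, hc⟩ := c
    obtain ⟨d, hd, rfl⟩ := (Set.ext_iff.1 hB c).1 hc
    have h := smul_smul_of_coe_eq φ (hC hd) (((z⁻¹ : Aˣ) : A) • x)
    simp only [← mul_smul] at h
    simp [← mul_smul, ← mul_assoc, h, mul_assoc _ _ (z : A)]

variable {V : Type*} [Fintype V] {e : V → A}

/-- Splittings over `z C z⁻¹` give splittings over the algebra generated by a complete set of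
orthogonal idempotents and the elements of `C` that are homogeneous with respect to these. -/
theorem isTransfer_adjoin (he : CompleteOrthogonalIdempotents e) {B C : Subalgebra k A} (z : Aˣ)
    (hB : (B : Set A) = {x | ∃ c ∈ C, x = z * c * (z⁻¹ : Aˣ)}) (R : Set A) (hRC : R ⊆ C)
    (hR : ∀ β ∈ R, ∃ i j, β = e j * β * e i) :
    IsTransfer B (Algebra.adjoin k (R ∪ Set.range e)) (fun i => e i * (z⁻¹ : Aˣ))
      (fun i => z * e i) where
  sum_mul := by simp [mul_assoc, (he.idem _).eq, he.complete]
  map_smul M N _ _ _ _ φ c x := by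
    obtain ⟨c, hc⟩ := c
    change ∑ i, (e i * ((z⁻¹ : Aˣ) : A)) • φ ((z * e i) • c • x) =
      c • ∑ i, (e i * ((z⁻¹ : Aˣ) : A)) • φ ((z * e i) • x)
    -- The elements commuting with the average form a subalgebra, so the generators decide. For a
    -- homogeneous one, orthogonality leaves a single summand on each side.
    induction hc using Algebra.adjoin_induction generalizing x with
    | mem c hc =>
      have left : ∀ (c : A) (j : V), c = e j * c →
          ∑ i, (e i * ((z⁻¹ : Aˣ) : A)) • φ ((z * e i) • c • x) =
            (e j * ((z⁻¹ : Aˣ) : A)) • φ ((z * c) • x) := fun c j hc => by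
        rw [Finset.sum_eq_single j _ (by simp), ← mul_smul, mul_assoc, ← hc]
        intro i _ hij
        rw [hc, ← mul_smul, mul_assoc, ← mul_assoc (e i), he.ortho hij]
        simp
      have right : ∀ (c : A) (i : V), c = c * e i →
          c • ∑ i, (e i * ((z⁻¹ : Aˣ) : A)) • φ ((z * e i) • x) =
            (c * ((z⁻¹ : Aˣ) : A)) • φ ((z * e i) • x) := fun c j hc => by
        rw [Finset.smul_sum, Finset.sum_eq_single j _ (by simp), ← mul_smul, ← mul_assoc, ← hc]
        intro i _ hij
        rw [hc, ← mul_smul, mul_assoc, ← mul_assoc (e j), he.ortho hij.symm]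
        simp
      rcases hc with hc | ⟨j, rfl⟩
      · obtain ⟨i, j, hβ⟩ := hR c hc
        have hl : c = e j * c := by
          rw [hβ, ← mul_assoc, ← mul_assoc, (he.idem j).eq]
        have hr : c = c * e i := by
          rw [hβ, mul_assoc _ (e i), (he.idem i).eq]
        rw [left c j hl, right c i hr]
        -- Since `c = c e i`, one has `z c = (z c z⁻¹)(z e i)`, and the first factor can be pulled
        -- out of the `B`-linear `φ`.
        have hmem : (z : A) * c * ((z⁻¹ : Aˣ) : A) ∈ B :=
          (Set.ext_iff.1 hB _).2 ⟨c, hRC hc, rfl⟩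
        have h : (z * c) • x = ((z : A) * c * ((z⁻¹ : Aˣ) : A)) • (z * e i) • x := by
          rw [← mul_smul]
          congr 1
          rw [mul_assoc _ _ ((z : A) * e i), Units.inv_mul_cancel_left, mul_assoc, ← hr]
        rw [h, smul_smul_of_coe_eq φ hmem, ← mul_smul]
        congr 1
        rw [mul_assoc (e j), mul_assoc (z : A), Units.inv_mul_cancel_left, ← mul_assoc, ← hl]
      -- For a vertex the two surviving summands coincide, so `e j` need not lie in `C`.
      · rw [left (e j) j (he.idem j).eq.symm, right (e j) j (he.idem j).eq.symm]
    | algebraMap r =>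
      have hr : ∀ (i : V) (y : M), (z * e i) • algebraMap k A r • y =
          algebraMap k A r • (z * e i) • y := fun i y => by
        rw [← mul_smul, ← mul_smul, Algebra.commutes]
      simp only [hr, smul_smul_of_coe_eq φ (B.algebraMap_mem r), Finset.smul_sum]
      exact Finset.sum_congr rfl fun i _ => by rw [← mul_smul, ← mul_smul, Algebra.commutes]
    | add c d _ _ hc hd => simp only [add_smul, smul_add, map_add, Finset.sum_add_distrib, hc, hd]
    | mul c d _ _ hc hd => simp only [mul_smul _ _ x, mul_smul c d, hc, hd]

end Conjugation

/-! ### Corners of the bound path algebra and the main theorem -/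

namespace PathAlgebra

variable {k : Type*} [Field k] {V : Type*} [Fintype V] [DecidableEq V] [Quiver V]
  (I : Ideal (PathAlgebra k V)) [I.IsTwoSided]

theorem completeOrthogonalIdempotents_vertexIn :
    CompleteOrthogonalIdempotents (vertexIn I : V → PathAlgebra k V ⧸ I) where
  idem i := by
    rw [IsIdempotentElem, vertexIn, ← map_mul, vertex, ofPath_mul_ofPath, Quiver.Path.comp_nil]
  ortho i j h := by
    change vertexIn I i * vertexIn I j = 0
    rw [vertexIn, vertexIn, ← map_mul, vertex, vertex, ofPath_mul_ofPath_of_ne _ _ h.symm, map_zero]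
  complete := by
    simp only [vertexIn, ← map_sum, ← one_def, map_one]

variable {I} in
/-- A subspace contains `f a e` for all `a` if it does for all paths from `e` to `f`. -/
theorem vertexIn_mul_mul_vertexIn_mem {S : Submodule k (PathAlgebra k V ⧸ I)} {i j : V}
    (h : ∀ p : Quiver.Path i j, Ideal.Quotient.mk I (ofPath k p) ∈ S) (a : PathAlgebra k V ⧸ I) :
    vertexIn I j * a * vertexIn I i ∈ S := by
  obtain ⟨a, rfl⟩ := Ideal.Quotient.mk_surjective a
  induction (basis k).mem_span a using Submodule.span_induction with
  | zero => simp
  | add x y _ _ hx hy => simpa [mul_add, add_mul] using S.add_mem hx hy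
  | smul r x _ hx =>
    have : Ideal.Quotient.mk I (r • x) = r • Ideal.Quotient.mk I x := rfl
    rw [this, mul_smul_comm, smul_mul_assoc]
    exact S.smul_mem r hx
  | mem x hx =>
    obtain ⟨⟨c, d, p⟩, rfl⟩ := hx
    change vertexIn I j * Ideal.Quotient.mk I (ofPath k p) * vertexIn I i ∈ S
    rw [vertexIn, vertexIn, ← map_mul, ← map_mul, vertex, vertex]
    by_cases hd : d = j
    · subst hd
      rw [ofPath_mul_ofPath]
      by_cases hc : i = c
      · subst hc
        rw [ofPath_mul_ofPath]
        exact h _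
      · rw [ofPath_mul_ofPath_of_ne _ _ hc, map_zero]
        exact S.zero_mem
    · rw [ofPath_mul_ofPath_of_ne _ _ hd, PathAlgebra.zero_mul, map_zero]
      exact S.zero_mem

variable {W : Type*} [LinearOrder W] {label : V → W}

theorem label_le_of_path {V : Type*} [Quiver V] {label : V → W}
    (hQ : ∀ i j : V, label i < label j → IsEmpty (i ⟶ j)) {i j : V}
    (p : Quiver.Path i j) : label j ≤ label i := by
  induction p with
  | nil => exact le_rfl
  | cons p α ih => exact (not_lt.1 fun h => (hQ _ _ h).false α).trans ih

/-- Labels cannot increase along a path, so a closed path has constant label; by injectivity it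
never leaves its vertex and is a product of loops. The separate equation `j = i` keeps the endpoint
free for the induction. -/
theorem mk_ofPath_mem (hQ : ∀ i j : V, label i < label j → IsEmpty (i ⟶ j))
    (hinj : Function.Injective label) {C : Subalgebra k (PathAlgebra k V ⧸ I)}
    (hv : ∀ i, vertexIn I i ∈ C) (hl : ∀ (i : V) (γ : i ⟶ i), arrowIn I γ ∈ C) {i j : V}
    (p : Quiver.Path i j) (hij : j = i) : Ideal.Quotient.mk I (ofPath k p) ∈ C := by
  induction p with
  | nil => exact hv i
  | @cons c d p α ih =>
    have hc : c = i := hinj ((label_le_of_path hQ p).antisymm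
      (hij ▸ label_le_of_path hQ α.toPath))
    obtain rfl : c = d := hc.trans hij.symm
    rw [← Quiver.Path.comp_toPath_eq_cons, ← ofPath_mul_ofPath, map_mul]
    exact C.mul_mem (hl c α) (ih hc)

end PathAlgebra

theorem mainTheorem5
    {k : Type*} [Field k] [IsAlgClosed k]
    {V : Type*} [Fintype V] [DecidableEq V] [Quiver V]
    (n : ℕ) (hn : 1 ≤ n) (label : V ≃ Fin n)
    (hQ : ∀ i j : V, label i < label j → IsEmpty (i ⟶ j))
    (I : Ideal (PathAlgebra k V)) [I.IsTwoSided] (hI : PathAlgebra.IsAdmissible I)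
    (R₀ R₁ : Set (PathAlgebra k V ⧸ I))
    (hR₀ : ∀ x ∈ R₀, ∃ S : Finset V, x = ∑ i ∈ S, PathAlgebra.vertexIn I i)
    (hR₁ : ∀ β ∈ R₁, ∃ e f : V, β = PathAlgebra.vertexIn I f * β * PathAlgebra.vertexIn I e)
    (hloops : ∀ (i : V) (γ : i ⟶ i), PathAlgebra.arrowIn I γ ∈ R₁)
    (B : Subalgebra k (PathAlgebra k V ⧸ I))
    (hB : IsConjugateSubalgebra B (Algebra.adjoin k (R₀ ∪ R₁))) :
    relGldim B ≤ ((n - 1 : ℕ) : ℕ∞) := by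
  obtain ⟨z, hz⟩ := hB
  have he := PathAlgebra.completeOrthogonalIdempotents_vertexIn I
  have hv : ∀ i, PathAlgebra.vertexIn I i ∈
      Algebra.adjoin k (R₁ ∪ Set.range (PathAlgebra.vertexIn I)) :=
    fun i => Algebra.subset_adjoin (Or.inr ⟨i, rfl⟩)
  have hle : Algebra.adjoin k (R₀ ∪ R₁) ≤
      Algebra.adjoin k (R₁ ∪ Set.range (PathAlgebra.vertexIn I)) := by
    refine Algebra.adjoin_le ?_
    rintro x (hx | hx)
    · obtain ⟨S, rfl⟩ := hR₀ x hx
      exact sum_mem fun i _ => hv i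
    · exact Algebra.subset_adjoin (Or.inl hx)
  have h₁ := isTransfer_adjoin he z hz R₁
    (Set.subset_union_right.trans Algebra.subset_adjoin) hR₁
  have h₂ := isTransfer_conj z hz hle
  refine iSup_le fun M => sInf_le ⟨n - 1, rfl, ?_⟩
  obtain ⟨r⟩ := nonempty_relProjResolution_of_triangular
    (C := Algebra.adjoin k (R₁ ∪ Set.range (PathAlgebra.vertexIn I)))
    (label := fun i => (label i : ℕ)) he.complete (fun i => (he.idem i).eq) hv
    (Fin.val_injective.comp label.injective)
    -- Triangularity is the case of the zero subspace: no path leads to a higher label.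
    (fun i j a hij => (Submodule.mem_bot k).1 <|
      PathAlgebra.vertexIn_mul_mul_vertexIn_mem
        (fun p => absurd (PathAlgebra.label_le_of_path hQ p) (not_le.2 hij)) a)
    (fun i a => (Subalgebra.mem_toSubmodule _).1 <| PathAlgebra.vertexIn_mul_mul_vertexIn_mem
      (fun p => PathAlgebra.mk_ofPath_mem I hQ label.injective hv
        (fun j γ => Algebra.subset_adjoin (Or.inl (hloops j γ))) p rfl) a)
    -- Labels run from `0` to `n - 1`, so any `M` satisfies the support condition for `t = n - 1`.
    (n - 1) M (fun j hj => by have := (label j).isLt; omega)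
  exact ⟨r.transfer h₁ h₂⟩
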